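/- Let $d\ge 1$ and let $\lambda$ be Lebesgue measure on $\mathbb R^d$ (with the Euclidean norm). For a sequence of sets $(A_i)$ put $\limsup A_i=\bigcap_{n}\bigcup_{i\ge n}A_i$. For $s\ge 0$ and a Borel set $E\subset\mathbb R^d$ let \[ \varphi^s(E)=\sup_\mu\ \inf_{x\in E}\ \inf_{r>0}\ \frac{r^s}{\mu(B_r(x))}\in[0,\infty], \] where the supremum is over the Borel probability measures $\mu$ with $\mu(\mathbb R^d\setminus E)=0$, $B_r(x)$ is the ball of radius $r$ centred at $x$, the quotient is $+\infty$ when $\mu(B_r(x))=0$, and $\varphi^s(\emptyset)=0$. Let $(B_i)$ be a sequence of (open or closed) balls of positive radius contained in $[0,1]^d$ with $\operatorname{diam} B_i\to 0$ and $\lambda(\limsup B_i)=1$. Let $(E_i)$ be a sequence of open sets with $E_i\subset B_i$. Assume that for some $s\ge 0$ every pair $(B_i,E_i)$ satisfies \[ \varphi^s(E_i)\ \ge\ \lambda(B_i). \] Then \[ \dim_{\mathcal H}\limsup E_i\ \ge\ s\qquad\text{and}\qquad \dim_{\mathcal P}\limsup E_i\ =\ d, \] where $\dim_{\mathcal H}$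 and $\dim_{\mathcal P}$ denote Hausdorff and packing dimension. -/

import Mathlib

open Set Filter Topology MeasureTheory
open scoped ENNReal NNReal

noncomputable section

/-- The unit cube `[0,1]^d` in the Euclidean space `ℝ^d`. -/
def unitCube (d : ℕ) : Set (EuclideanSpace ℝ (Fin d)) :=
  {x | ∀ j, x j ∈ Set.Icc (0 : ℝ) 1}

/-- `B` is a (nondegenerate) ball, open or closed. -/
def IsOpenOrClosedBall {X : Type*} [PseudoMetricSpace X] (B : Set X) : Prop :=
  ∃ (c : X) (r : ℝ), 0 < r ∧ (B = Metric.ball c r ∨ B = Metric.closedBall c r)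

/-- The generalized singular value function
`φ^s(E) = sup_μ inf_{x ∈ E} inf_{r > 0} r^s / μ(B_r(x))`,
where `μ` runs over the Borel probability measures with `μ(Eᶜ) = 0`. The quotient is taken in
`[0, ∞]`, with the value `∞` where `μ(B_r(x)) = 0`; the value at `E = ∅` is `0`. -/
def singularValueFun {X : Type*} [PseudoMetricSpace X] [MeasurableSpace X]
    (s : ℝ) (E : Set X) : ℝ≥0∞ :=
  ⨆ (μ : Measure X) (_ : IsProbabilityMeasure μ) (_ : μ Eᶜ = 0),
    ⨅ (x : X) (_ : x ∈ E) (r : ℝ) (_ : 0 < r),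
      ENNReal.ofReal (r ^ s) / μ (Metric.ball x r)

/-- `P` is a `δ`-packing of `A`: a countable family of pairwise disjoint closed balls, given as
pairs (centre, radius), with centres in `A` and radii in `(0, δ]`. -/
def IsBallPacking {X : Type*} [PseudoMetricSpace X] (δ : ℝ) (A : Set X)
    (P : Set (X × ℝ)) : Prop :=
  P.Countable ∧ (∀ p ∈ P, p.1 ∈ A ∧ 0 < p.2 ∧ p.2 ≤ δ) ∧
    P.PairwiseDisjoint (fun p => Metric.closedBall p.1 p.2)

/-- `P^s_δ(A)`: the supremum of `∑ (2 r)^s` over the `δ`-packings of `A`. -/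
def packingPreSup {X : Type*} [PseudoMetricSpace X] (s : ℝ≥0) (δ : ℝ) (A : Set X) : ℝ≥0∞ :=
  ⨆ (P : Set (X × ℝ)) (_ : IsBallPacking δ A P),
    ∑' p : P, ENNReal.ofReal ((2 * (p : X × ℝ).2) ^ (s : ℝ))

/-- The packing premeasure `P^s_0(A) = lim_{δ → 0} P^s_δ(A)`, the limit of a quantity that
decreases with `δ`. -/
def packingPremeasure {X : Type*} [PseudoMetricSpace X] (s : ℝ≥0) (A : Set X) : ℝ≥0∞ :=
  ⨅ (δ : ℝ) (_ : 0 < δ), packingPreSup s δ A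

/-- The `s`-dimensional packing (outer) measure: the infimum of `∑ P^s_0(A_n)` over the countable
covers `(A_n)` of `A`. -/
def packingMeasure {X : Type*} [PseudoMetricSpace X] (s : ℝ≥0) (A : Set X) : ℝ≥0∞ :=
  ⨅ (F : ℕ → Set X) (_ : A ⊆ ⋃ n, F n), ∑' n, packingPremeasure s (F n)

/-- The packing dimension `dim_P A = sup {s ≥ 0 | P^s(A) = ∞}` (with `sup ∅ = 0`). -/
def packingDim {X : Type*} [PseudoMetricSpace X] (A : Set X) : ℝ≥0∞ :=
  ⨆ (s : ℝ≥0) (_ : packingMeasure s A = ∞), (s : ℝ≥0∞)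

end

/-! Hausdorff dimension. Fix `t < s`. The bound on `singularValueFun` gives, on each `E i`, a
probability measure `μ i` with `vol (B i) * μ i (ball x r) ≤ C r^s`; smoothing makes its density
bounded. Start from twice Lebesgue measure on the open cube. Given `ν` of bounded density with `ν
(ball x r) ≤ A r^t`, pack almost all of `ν` into tiny disjoint balls `B i` and spread the mass `ν (B
i)` over `E i` by `μ i`. At large scales `ν` hardly changes. At small scales the density bound
controls the new mass of a ball by a multiple of `r^d + r^s`, which is below `A r^t` because `t < d`
and `t < s`. Hence `A` grows by as little as desired (`IsFrostmanOn.exists_refinement`), and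
iteration gives nested sets with compact closures whose intersection lies in `limsup E`. No limit
measure is taken: a neighbourhood of the intersection contains some stage of the construction, and
`le_dimH_of_forall_isOpen_exists_measure` lets the measure depend on the neighbourhood.

Packing dimension. The `E i` are nonempty and the `B i` shrink, so `limsup E` contains a countable
intersection of open sets dense in the cube. By Baire, some member of any countable cover is
somewhere dense, and such a set has infinite packing premeasure in every exponent below `d`. -/

/-! ### Mass distribution and Vitali covering. -/

/-- Mass distribution principle. -/
theorem le_dimH_of_forall_isOpen_exists_measure {X : Type*} [MetricSpace X] [MeasurableSpace X]
    [BorelSpace X] {K : Set X} {t A : ℝ} (ht : 0 < t) (hA : 0 < A)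
    (h : ∀ W, IsOpen W → K ⊆ W → ∃ ν : Measure X, 1 ≤ ν W ∧
      ∀ x r, 0 < r → ν (Metric.ball x r) ≤ ENNReal.ofReal (A * r ^ t)) :
    ENNReal.ofReal t ≤ dimH K := by
  by_contra! hlt
  have h0 : μH[t] K = 0 := by
    have := hausdorffMeasure_of_dimH_lt (s := K) (d := t.toNNReal) hlt
    rwa [Real.coe_toNNReal _ ht.le] at this
  -- One `ε` pays for the cover, the other for enlarging its members to open sets.
  obtain ⟨ε, hε, hεA⟩ : ∃ ε : ℝ, 0 < ε ∧ A * (2 * ε) < 1 :=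
    ⟨1 / (4 * A), by positivity, by field_simp; norm_num⟩
  rw [Measure.hausdorffMeasure_apply] at h0
  -- Any scale would do; the scale `1` only serves to make the diameters finite.
  have h1 := (le_iSup₂ (f := fun (r : ℝ≥0∞) (_ : 0 < r) =>
    ⨅ (v : ℕ → Set X) (_ : K ⊆ ⋃ n, v n) (_ : ∀ n, Metric.ediam (v n) ≤ r),
      ∑' n, ⨆ _ : (v n).Nonempty, Metric.ediam (v n) ^ t) 1 one_pos).trans h0.le
  have h2 := h1.trans_lt (ENNReal.ofReal_pos.2 hε)
  simp only [iInf_lt_iff] at h2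
  obtain ⟨v, hKv, hv1, hv⟩ := h2
  obtain ⟨e, he, hesum⟩ := ENNReal.exists_pos_sum_of_countable (ENNReal.ofReal_pos.2 hε).ne' ℕ
  -- The open set `U` must not depend on `ν`, since `ν` is only supplied once the union of all these
  -- sets is known.
  have key : ∀ n, ∃ U : Set X, IsOpen U ∧ v n ⊆ U ∧ ∀ ν : Measure X,
      (∀ x r, 0 < r → ν (Metric.ball x r) ≤ ENNReal.ofReal (A * r ^ t)) →
      ν U ≤ ENNReal.ofReal A *
        ((⨆ _ : (v n).Nonempty, Metric.ediam (v n) ^ t) + e n) := by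
    intro n
    rcases (v n).eq_empty_or_nonempty with hn | hn
    · exact ⟨∅, isOpen_empty, hn.subset, fun ν _ => by simp⟩
    obtain ⟨x, hx⟩ := hn
    have hfin : Metric.ediam (v n) ≠ ∞ := ((hv1 n).trans_lt ENNReal.one_lt_top).ne
    set D := (Metric.ediam (v n)).toReal with hD
    have hD0 : 0 ≤ D := ENNReal.toReal_nonneg
    have hcont : ContinuousAt (fun r : ℝ => r ^ t) D :=
      Real.continuousAt_rpow_const _ _ (Or.inr ht.le)
    have hev : ∀ᶠ r in 𝓝[>] D, r ^ t < D ^ t + e n :=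
      (hcont.eventually_lt continuousAt_const (by
        have : (0 : ℝ) < e n := he n
        linarith)).filter_mono nhdsWithin_le_nhds
    obtain ⟨r, hr, hDr⟩ := (hev.and self_mem_nhdsWithin).exists
    have hDr : D < r := hDr
    refine ⟨Metric.ball x r, Metric.isOpen_ball, fun y hy => ?_, fun ν hν => ?_⟩
    · rw [Metric.mem_ball, dist_edist]
      exact (ENNReal.toReal_mono hfin (Metric.edist_le_ediam_of_mem hy hx)).trans_lt hDr
    · refine (hν x r (hD0.trans_lt hDr)).trans ?_
      rw [ENNReal.ofReal_mul hA.le]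
      gcongr
      rw [ciSup_pos ⟨x, hx⟩]
      refine (ENNReal.ofReal_le_ofReal hr.le).trans ?_
      rw [ENNReal.ofReal_add (by positivity) (by positivity), ENNReal.ofReal_coe_nnreal,
        ← ENNReal.ofReal_rpow_of_nonneg hD0 ht.le, hD, ENNReal.ofReal_toReal hfin]
  choose U hUo hvU hU using key
  obtain ⟨ν, hν1, hν⟩ := h (⋃ n, U n) (isOpen_iUnion hUo)
    (hKv.trans (iUnion_mono hvU))
  have : ν (⋃ n, U n) < 1 := by
    calc ν (⋃ n, U n) ≤ ∑' n, ν (U n) := measure_iUnion_le _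
      _ ≤ ∑' n, ENNReal.ofReal A *
          ((⨆ _ : (v n).Nonempty, Metric.ediam (v n) ^ t) + e n) :=
        ENNReal.tsum_le_tsum fun n => hU n ν hν
      _ ≤ ENNReal.ofReal A * (ENNReal.ofReal ε + ENNReal.ofReal ε) := by
        rw [ENNReal.tsum_mul_left, ENNReal.tsum_add]
        gcongr
      _ < 1 := by
        rw [← ENNReal.ofReal_add hε.le hε.le, ← ENNReal.ofReal_mul hA.le, ← two_mul,
          ← ENNReal.ofReal_one]
        exact (ENNReal.ofReal_lt_ofReal_iff one_pos).2 hεA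
  exact absurd hν1 this.not_ge

/-- Vitali covering theorem for closed balls that need not be centred at the points they cover. -/
theorem exists_pairwiseDisjoint_closedBall_covering_ae {E ι : Type*} [NormedAddCommGroup E]
    [NormedSpace ℝ E] [FiniteDimensional ℝ E] [MeasurableSpace E] [BorelSpace E]
    (μ : Measure E) [μ.IsAddHaarMeasure] (s : Set E) (t : Set ι) (c : ι → E) (r : ι → ℝ)
    (hr : ∀ i ∈ t, 0 < r i)
    (hf : ∀ x ∈ s, ∀ ε > (0 : ℝ), ∃ i ∈ t, r i ≤ ε ∧ x ∈ Metric.closedBall (c i) (r i)) :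
    ∃ u ⊆ t, u.Countable ∧ u.PairwiseDisjoint (fun i => Metric.closedBall (c i) (r i)) ∧
      μ (s \ ⋃ i ∈ u, Metric.closedBall (c i) (r i)) = 0 := by
  -- The index is a ball together with any of its points, which then plays the role of centre with
  -- radius `2 r`; tripling gives `6 r`, hence the constant `6 ^ finrank`.
  obtain ⟨u, hut, huc, hud, hus⟩ := Vitali.exists_disjoint_covering_ae μ s
    {p : ι × E | p.1 ∈ t ∧ p.2 ∈ Metric.closedBall (c p.1) (r p.1)}
    ((6 : ℝ≥0) ^ Module.finrank ℝ E) (fun p => 2 * r p.1) (fun p => p.2)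
    (fun p => Metric.closedBall (c p.1) (r p.1))
    (fun p hp => Metric.closedBall_subset_closedBall' (by
      have := Metric.mem_closedBall'.1 hp.2
      linarith))
    (fun p hp => by
      have h0 := hr _ hp.1
      rw [Measure.addHaar_closedBall _ _ (by positivity), Measure.addHaar_closedBall _ _ h0.le,
        show 3 * (2 * r p.1) = 6 * r p.1 by ring, mul_pow,
        ENNReal.ofReal_mul (by positivity), ENNReal.ofReal_pow (by positivity), mul_assoc]
      simp)
    (fun p hp => by
      refine ⟨c p.1, mem_interior_iff_mem_nhds.2 (Metric.closedBall_mem_nhds _ (hr _ hp.1))⟩)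
    (fun p _ => Metric.isClosed_closedBall)
    (fun x hx ε hε => by
      obtain ⟨i, hi, hiε, hxi⟩ := hf x hx (ε / 2) (by positivity)
      exact ⟨(i, x), ⟨hi, hxi⟩, by simp only; linarith, rfl⟩)
  refine ⟨Prod.fst '' u, ?_, huc.image _, ?_, ?_⟩
  · rintro _ ⟨p, hp, rfl⟩
    exact (hut hp).1
  · rintro _ ⟨p, hp, rfl⟩ _ ⟨q, hq, rfl⟩ hpq
    exact hud hp hq (ne_of_apply_ne _ hpq)
  · rwa [biUnion_image]

/-! ### The unit cube. -/

theorem volume_unitCube (d : ℕ) : volume (unitCube d) = 1 := by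
  have : unitCube d = (WithLp.ofLp : EuclideanSpace ℝ (Fin d) → _) ⁻¹'
      (Set.univ.pi fun _ => Set.Icc (0 : ℝ) 1) := by
    ext x; simp only [unitCube, mem_ofPred_eq, mem_preimage, mem_univ_pi]
  rw [this, (PiLp.volume_preserving_ofLp (Fin d)).measure_preimage
    (MeasurableSet.univ_pi fun _ => measurableSet_Icc).nullMeasurableSet, volume_pi_pi]
  simp

/-- The open unit cube `(0,1)^d`. -/
def openUnitCube (d : ℕ) : Set (EuclideanSpace ℝ (Fin d)) :=
  {x | ∀ j, x j ∈ Set.Ioo (0 : ℝ) 1}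

theorem volume_openUnitCube (d : ℕ) : volume (openUnitCube d) = 1 := by
  have : openUnitCube d = (WithLp.ofLp : EuclideanSpace ℝ (Fin d) → _) ⁻¹'
      (Set.univ.pi fun _ => Set.Ioo (0 : ℝ) 1) := by
    ext x; simp [openUnitCube]
  rw [this, (PiLp.volume_preserving_ofLp (Fin d)).measure_preimage
    (MeasurableSet.univ_pi fun _ => measurableSet_Ioo).nullMeasurableSet, volume_pi_pi]
  simp

theorem openUnitCube_subset (d : ℕ) : openUnitCube d ⊆ unitCube d :=
  fun _ hx j => Ioo_subset_Icc_self (hx j)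

theorem isOpen_openUnitCube (d : ℕ) : IsOpen (openUnitCube d) := by
  have : openUnitCube d = (WithLp.ofLp : EuclideanSpace ℝ (Fin d) → _) ⁻¹'
      (Set.univ.pi fun _ => Set.Ioo (0 : ℝ) 1) := by
    ext x; simp [openUnitCube]
  rw [this]
  exact (isOpen_set_pi finite_univ fun _ _ => isOpen_Ioo).preimage
    (PiLp.continuous_ofLp 2 _)

theorem isBounded_unitCube (d : ℕ) : Bornology.IsBounded (unitCube d) := by
  have : unitCube d = (WithLp.ofLp : EuclideanSpace ℝ (Fin d) → _) ⁻¹'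
      (Set.univ.pi fun _ => Set.Icc (0 : ℝ) 1) := by
    ext x; simp only [unitCube, mem_ofPred_eq, mem_preimage, mem_univ_pi]
  rw [this]
  exact (PiLp.antilipschitzWith_ofLp 2 (fun _ : Fin d => ℝ)).isBounded_preimage
    (Bornology.IsBounded.pi fun _ => Metric.isBounded_Icc 0 1)

/-! ### Frostman measures on the sets `E i`, and their smoothing. -/

theorem exists_measure_of_lt_singularValueFun {X : Type*} [PseudoMetricSpace X]
    [MeasurableSpace X] {s : ℝ} {O : Set X} {a : ℝ≥0∞} (h : a < singularValueFun s O) :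
    ∃ μ : Measure X, IsProbabilityMeasure μ ∧ μ Oᶜ = 0 ∧
      ∀ x ∈ O, ∀ r : ℝ, 0 < r → a * μ (Metric.ball x r) ≤ ENNReal.ofReal (r ^ s) := by
  unfold singularValueFun at h
  simp only [lt_iSup_iff] at h
  obtain ⟨μ, hμ, hμO, hlt⟩ := h
  refine ⟨μ, hμ, hμO, fun x hx r hr => ENNReal.mul_le_of_le_div (hlt.le.trans ?_)⟩
  exact (iInf₂_le x hx).trans (iInf₂_le r hr)

/-- A probability measure on an open set can be restricted to a compact subset at the cost of a
constant factor in its Frostman condition, which then holds for all centres. -/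
theorem exists_isCompact_measure_of_frostman {X : Type*} [MetricSpace X] [ProperSpace X]
    [MeasurableSpace X] [BorelSpace X] {s : ℝ} {O : Set X} (hO : IsOpen O) {a : ℝ≥0∞}
    (μ : Measure X) [IsProbabilityMeasure μ] (hμ : μ Oᶜ = 0)
    (h : ∀ x ∈ O, ∀ r : ℝ, 0 < r → a * μ (Metric.ball x r) ≤ ENNReal.ofReal (r ^ s)) :
    ∃ K ⊆ O, IsCompact K ∧ ∃ μ' : Measure X, IsProbabilityMeasure μ' ∧ μ' Kᶜ = 0 ∧
      ∀ x, ∀ r : ℝ, 0 < r →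
        a * μ' (Metric.ball x r) ≤ ENNReal.ofReal (2 * 2 ^ s * r ^ s) := by
  have hO1 : μ O = 1 := (prob_compl_eq_zero_iff hO.measurableSet).1 hμ
  obtain ⟨K, hKO, hK, hKμ⟩ := hO.exists_lt_isCompact (μ := μ) (r := 2⁻¹)
    (by rw [hO1]; exact ENNReal.inv_lt_one.2 ENNReal.one_lt_two)
  have hK0 : μ K ≠ 0 := (bot_le.trans_lt hKμ).ne'
  refine ⟨K, hKO, hK, ProbabilityTheory.cond μ K,
    ProbabilityTheory.cond_isProbabilityMeasure hK0, ?_, fun x r hr => ?_⟩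
  · rw [ProbabilityTheory.cond_apply hK.measurableSet]
    simp
  · rw [ProbabilityTheory.cond_apply hK.measurableSet]
    rcases (K ∩ Metric.ball x r).eq_empty_or_nonempty with he | ⟨y, hyK, hyr⟩
    · simp [he]
    have hinv : (μ K)⁻¹ ≤ 2 := by
      rw [ENNReal.inv_le_iff_inv_le]; exact hKμ.le
    -- The Frostman bound is known only at centres in `O`: recentring at a point of `K` doubles the
    -- radius, and normalising costs another factor `2`.
    have hsub : K ∩ Metric.ball x r ⊆ Metric.ball y (2 * r) :=
      inter_subset_right.trans (Metric.ball_subset_ball' (by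
        have := Metric.mem_ball'.1 hyr
        linarith))
    calc a * ((μ K)⁻¹ * μ (K ∩ Metric.ball x r))
        ≤ a * (2 * μ (Metric.ball y (2 * r))) := by gcongr
      _ = 2 * (a * μ (Metric.ball y (2 * r))) := by ring
      _ ≤ 2 * ENNReal.ofReal ((2 * r) ^ s) := by
        gcongr
        exact h y (hKO hyK) _ (by positivity)
      _ = ENNReal.ofReal (2 * 2 ^ s * r ^ s) := by
        rw [Real.mul_rpow zero_le_two hr.le, mul_assoc, ENNReal.ofReal_mul zero_le_two]
        simp

/-- Convolution with the uniform distribution on a small ball makes a compactly supported measure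
absolutely continuous with bounded density, without increasing the measure of balls. -/
theorem exists_le_smul_measure_of_isCompact {E : Type*} [NormedAddCommGroup E]
    [NormedSpace ℝ E] [FiniteDimensional ℝ E] [MeasurableSpace E] [BorelSpace E]
    (vol : Measure E) [vol.IsAddHaarMeasure] {K O : Set E} (hK : IsCompact K) (hO : IsOpen O)
    (hKO : K ⊆ O) (μ : Measure E) [IsProbabilityMeasure μ] (hμ : μ Kᶜ = 0) :
    ∃ V, IsOpen V ∧ IsCompact (closure V) ∧ closure V ⊆ O ∧ ∃ ν : Measure E,
      ν univ = 1 ∧ ν Vᶜ = 0 ∧ (∃ M : ℝ≥0, ∀ A, MeasurableSet A → ν A ≤ M * vol A) ∧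
      ∀ r b, (∀ y, μ (Metric.ball y r) ≤ b) → ∀ x, ν (Metric.ball x r) ≤ b := by
  have : ProperSpace E := FiniteDimensional.proper_real E
  obtain ⟨δ, hδ, hδO⟩ := hK.exists_cthickening_subset_open hO hKO
  have hcl : closure (Metric.thickening δ K) ⊆ Metric.cthickening δ K :=
    Metric.closure_thickening_subset_cthickening δ K
  have hb0 : vol (Metric.ball (0 : E) δ) ≠ 0 := (Metric.measure_ball_pos _ _ hδ).ne'
  set η := ProbabilityTheory.cond vol (Metric.ball (0 : E) δ) with hη
  have hηprob : IsProbabilityMeasure η :=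
    ProbabilityTheory.cond_isProbabilityMeasure_of_finite hb0 measure_ball_lt_top.ne
  have hadd : Measurable (fun p : E × E => p.1 + p.2) := measurable_add
  refine ⟨Metric.thickening δ K, Metric.isOpen_thickening,
    hK.cthickening.of_isClosed_subset isClosed_closure hcl, hcl.trans hδO,
    (μ.prod η).map (fun p : E × E => p.1 + p.2), ?_, ?_, ?_, ?_⟩
  · rw [Measure.map_apply hadd .univ]; simp
  · rw [Measure.map_apply hadd Metric.isOpen_thickening.measurableSet.compl]
    have hsub : (fun p : E × E => p.1 + p.2) ⁻¹' (Metric.thickening δ K)ᶜ ⊆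
        (Kᶜ ×ˢ univ) ∪ (univ ×ˢ (Metric.ball (0 : E) δ)ᶜ) := by
      rintro ⟨x, y⟩ hxy
      by_contra hcon
      simp only [mem_union, mem_prod, mem_compl_iff, mem_univ, and_true, true_and, not_or,
        not_not] at hcon
      refine hxy (Metric.mem_thickening_iff.2 ⟨x, hcon.1, ?_⟩)
      simpa using hcon.2
    refine measure_mono_null hsub (measure_union_null ?_ ?_)
    · rw [Measure.prod_prod, hμ, zero_mul]
    · rw [Measure.prod_prod, hη, ProbabilityTheory.cond_apply measurableSet_ball]
      simp
  · refine ⟨(vol (Metric.ball (0 : E) δ))⁻¹.toNNReal, fun A hA => ?_⟩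
    rw [ENNReal.coe_toNNReal (ENNReal.inv_ne_top.2 hb0), Measure.map_apply hadd hA,
      Measure.prod_apply (hadd hA)]
    calc ∫⁻ x, η (Prod.mk x ⁻¹' ((fun p : E × E => p.1 + p.2) ⁻¹' A)) ∂μ
        ≤ ∫⁻ _, (vol (Metric.ball (0 : E) δ))⁻¹ * vol A ∂μ := by
          refine lintegral_mono fun x => ?_
          simp only
          rw [hη, ProbabilityTheory.cond_apply measurableSet_ball]
          exact mul_le_mul' le_rfl ((measure_mono inter_subset_right).trans
            (measure_preimage_add vol x A).le)
      _ = _ := by simp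
  -- For each fixed shift `y` the slice is a ball of the same radius about `x - y`, so a bound
  -- uniform in the centre survives averaging.
  · intro r b hb x
    rw [Measure.map_apply hadd measurableSet_ball,
      Measure.prod_apply_symm (hadd measurableSet_ball)]
    calc ∫⁻ y, μ ((fun x => (x, y)) ⁻¹'
          ((fun p : E × E => p.1 + p.2) ⁻¹' Metric.ball x r)) ∂η
        ≤ ∫⁻ _, b ∂η := by
          refine lintegral_mono fun y => (measure_mono ?_).trans (hb (x - y))
          intro z hz
          simp only [mem_preimage, Metric.mem_ball, dist_eq_norm] at hz ⊢
          rwa [← sub_add, sub_add_eq_add_sub]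
      _ = b := by simp

/-! ### Ball estimates at small and large scales. -/

theorem exists_forall_lt_add_rpow_le {a b p q t A : ℝ} (hp : t < p) (hq : t < q) (hA : 0 < A) :
    ∃ δ > 0, ∀ r, 0 < r → r < δ → a * r ^ p + b * r ^ q ≤ A * r ^ t := by
  have h : ∀ w, t < w → Tendsto (fun r : ℝ => r ^ (w - t)) (𝓝[>] 0) (𝓝 0) := fun w hw => by
    have := (Real.continuousAt_rpow_const (0 : ℝ) (w - t) (Or.inr (by linarith))).tendsto
    rw [Real.zero_rpow (by linarith)] at this
    exact this.mono_left nhdsWithin_le_nhds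
  have h2 : Tendsto (fun r : ℝ => a * r ^ (p - t) + b * r ^ (q - t)) (𝓝[>] 0) (𝓝 0) := by
    simpa using ((h p hp).const_mul a).add ((h q hq).const_mul b)
  obtain ⟨δ, hδ, hsub⟩ := mem_nhdsGT_iff_exists_Ioo_subset.1 (h2.eventually (gt_mem_nhds hA))
  refine ⟨δ, hδ, fun r hr hrδ => ?_⟩
  have h3 : a * r ^ (p - t) + b * r ^ (q - t) < A := hsub ⟨hr, hrδ⟩
  have h4 : 0 < r ^ t := Real.rpow_pos_of_pos hr t
  rw [Real.rpow_sub hr, Real.rpow_sub hr] at h3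
  calc a * r ^ p + b * r ^ q = (a * (r ^ p / r ^ t) + b * (r ^ q / r ^ t)) * r ^ t := by
        field_simp
    _ ≤ A * r ^ t := by gcongr

theorem exists_forall_ge_add_rpow_le {t A A' δ : ℝ} (ht : 0 < t) (hA : 0 < A) (hAA' : A < A')
    (hδ : 0 < δ) : ∃ ρ > 0, ∀ r, δ ≤ r → A * (r + 2 * ρ) ^ t ≤ A' * r ^ t := by
  have h : Tendsto (fun η : ℝ => A * (1 + η) ^ t) (𝓝[>] 0) (𝓝 A) := by
    have : ContinuousAt (fun η : ℝ => A * (1 + η) ^ t) 0 :=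
      continuousAt_const.mul ((continuousAt_const.add continuousAt_id).rpow_const (Or.inr ht.le))
    have := this.tendsto
    simp only [add_zero, Real.one_rpow, mul_one] at this
    exact this.mono_left nhdsWithin_le_nhds
  obtain ⟨η, hη, hη0⟩ := ((h.eventually (gt_mem_nhds hAA')).and self_mem_nhdsWithin).exists
  have hη0 : 0 < η := hη0
  refine ⟨η * δ / 2, by positivity, fun r hr => ?_⟩
  have hr0 : 0 < r := hδ.trans_le hr
  calc A * (r + 2 * (η * δ / 2)) ^ t ≤ A * ((1 + η) * r) ^ t := by
        gcongr
        nlinarith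
    _ = A * (1 + η) ^ t * r ^ t := by rw [Real.mul_rpow (by positivity) hr0.le]; ring
    _ ≤ A' * r ^ t := by gcongr

/-- A ball of radius `r` centred near a ball of larger radius `R` contains, after tripling, a ball
of radius `r` inside the larger ball. -/
theorem exists_ball_subset_closedBall_inter_ball {E : Type*} [NormedAddCommGroup E]
    [NormedSpace ℝ E] {c x y : E} {R r : ℝ} (hr : 0 < r) (hrR : r ≤ R)
    (hyc : y ∈ Metric.closedBall c R) (hyx : y ∈ Metric.ball x r) :
    ∃ z, Metric.ball z r ⊆ Metric.closedBall c R ∩ Metric.ball x (3 * r) := by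
  have hR : 0 < R := hr.trans_le hrR
  have hyc' : ‖y - c‖ ≤ R := by simpa [dist_eq_norm] using hyc
  have hyx' : ‖y - x‖ < r := by simpa [dist_eq_norm] using hyx
  have hq0 : 0 ≤ r / R := by positivity
  have hq1 : r / R ≤ 1 := (div_le_one hR).2 hrR
  -- Pulling `y` towards `c` by the fraction `r / R` moves it by at most `r` and leaves it within `R
  -- - r` of `c`.
  refine ⟨y - (r / R) • (y - c), subset_inter (fun w hw => ?_) (fun w hw => ?_)⟩
  · rw [Metric.mem_ball, dist_eq_norm] at hw
    rw [Metric.mem_closedBall, dist_eq_norm]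
    have h1 : w - c = (w - (y - (r / R) • (y - c))) + (1 - r / R) • (y - c) := by module
    rw [h1]
    refine (norm_add_le _ _).trans ?_
    rw [norm_smul, Real.norm_of_nonneg (by linarith)]
    have h2 : (1 - r / R) * ‖y - c‖ ≤ (1 - r / R) * R :=
      mul_le_mul_of_nonneg_left hyc' (by linarith)
    have h3 : (1 - r / R) * R = R - r := by field_simp
    linarith
  · rw [Metric.mem_ball, dist_eq_norm] at hw ⊢
    have h1 : w - x = (w - (y - (r / R) • (y - c))) + (y - x) - (r / R) • (y - c) := by module
    rw [h1]
    refine (norm_sub_le _ _).trans_lt ?_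
    have h2 := norm_add_le (w - (y - (r / R) • (y - c))) (y - x)
    have h3 : ‖(r / R) • (y - c)‖ ≤ r := by
      rw [norm_smul, Real.norm_of_nonneg hq0]
      calc r / R * ‖y - c‖ ≤ r / R * R := by gcongr
        _ = r := by field_simp
    linarith

section

variable {E : Type*} [NormedAddCommGroup E] [MeasurableSpace E]

/-- `ν` is carried by `U`, has mass larger than `1` and bounded density, and satisfies the Frostman
condition `ν (B_r(x)) ≤ A r^t`. -/
structure IsFrostmanOn (vol : Measure E) (t A : ℝ) (U : Set E) (ν : Measure E) : Prop where
  exists_le : ∃ M : ℝ≥0, ∀ T, MeasurableSet T → ν T ≤ M * vol T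
  compl_eq_zero : ν Uᶜ = 0
  one_lt : 1 < ν univ
  ball_le : ∀ x r, 0 < r → ν (Metric.ball x r) ≤ ENNReal.ofReal (A * r ^ t)

variable [NormedSpace ℝ E] [FiniteDimensional ℝ E] [BorelSpace E]

/-- The bound is by the volume of a piece of the carrying ball, so that it can be summed over
disjoint balls. If `R ≤ r` the piece is the whole ball and bounded density suffices; if `r ≤ R` the
piece contains a ball of radius `r`, and the Frostman bound on `μ` applies. -/
theorem mul_measure_ball_le_mul_inter (vol : Measure E) [vol.IsAddHaarMeasure] {ν μ : Measure E}
    {c x : E} {R r s C : ℝ} {M : ℝ≥0} (hr : 0 < r)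
    (hν : ν (Metric.closedBall c R) ≤ M * vol (Metric.closedBall c R))
    (hμ1 : μ univ = 1) (hμc : μ (Metric.closedBall c R)ᶜ = 0)
    (hμ : vol (Metric.closedBall c R) * μ (Metric.ball x r) ≤ ENNReal.ofReal (C * r ^ s)) :
    ν (Metric.closedBall c R) * μ (Metric.ball x r) ≤
      (M + M * (ENNReal.ofReal (C * r ^ s) / vol (Metric.ball 0 r))) *
        vol (Metric.closedBall c R ∩ Metric.ball x (3 * r)) := by
  rcases (Metric.closedBall c R ∩ Metric.ball x r).eq_empty_or_nonempty with he | ⟨y, hyc, hyx⟩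
  · have : μ (Metric.ball x r) = 0 :=
      measure_mono_null (fun z hz hzc => (he.subset ⟨hzc, hz⟩ : z ∈ (∅ : Set E))) hμc
    simp [this]
  rw [add_mul]
  rcases le_total R r with hRr | hrR
  · refine le_add_right ?_
    have hsub : Metric.closedBall c R ⊆ Metric.ball x (3 * r) := fun z hz => by
      have h1 := Metric.mem_closedBall.1 hz
      have h2 := Metric.mem_closedBall'.1 hyc
      have h3 := Metric.mem_ball.1 hyx
      have h4 := dist_triangle4 z c y x
      rw [Metric.mem_ball]
      linarith
    rw [inter_eq_left.2 hsub]
    calc ν (Metric.closedBall c R) * μ (Metric.ball x r)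
        ≤ M * vol (Metric.closedBall c R) * 1 := by
          gcongr
          exact hμ1 ▸ measure_mono (subset_univ _)
      _ = _ := mul_one _
  · refine le_add_left ?_
    obtain ⟨z, hz⟩ := exists_ball_subset_closedBall_inter_ball hr hrR hyc hyx
    have hb0 : vol (Metric.ball (0 : E) r) ≠ 0 := (Metric.measure_ball_pos _ _ hr).ne'
    have hbt : vol (Metric.ball (0 : E) r) ≠ ∞ := measure_ball_lt_top.ne
    calc ν (Metric.closedBall c R) * μ (Metric.ball x r)
        ≤ M * vol (Metric.closedBall c R) * μ (Metric.ball x r) := by gcongr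
      _ ≤ M * ENNReal.ofReal (C * r ^ s) := by rw [mul_assoc]; gcongr
      _ = M * (ENNReal.ofReal (C * r ^ s) / vol (Metric.ball 0 r)) *
          vol (Metric.ball 0 r) := by
        rw [mul_assoc, ENNReal.div_mul_cancel hb0 hbt]
      _ ≤ _ := by
        rw [← Measure.addHaar_ball_center vol z r]
        gcongr

end

section

variable {E : Type*} [NormedAddCommGroup E] [MeasurableSpace E]
variable [NormedSpace ℝ E] [FiniteDimensional ℝ E] [BorelSpace E]

/-- The pieces are disjoint and lie in `ball x (3 * r)`, so their volumes add up to at most `3^n`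
times that of a ball of radius `r`, however many there are. -/
theorem sum_mul_measure_ball_le (vol : Measure E) [vol.IsAddHaarMeasure] {ν : Measure E}
    {c : ℕ → E} {ρ : ℕ → ℝ} {μ : ℕ → Measure E} {x : E} {r s C : ℝ} {M : ℝ≥0} (hr : 0 < r)
    (hC : 0 ≤ C) (hν : ∀ T, MeasurableSet T → ν T ≤ M * vol T)
    (hμ1 : ∀ i, μ i univ = 1) (hμc : ∀ i, μ i (Metric.closedBall (c i) (ρ i))ᶜ = 0)
    (hμ : ∀ i, vol (Metric.closedBall (c i) (ρ i)) * μ i (Metric.ball x r) ≤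
      ENNReal.ofReal (C * r ^ s)) {F : Finset ℕ}
    (hF : (F : Set ℕ).PairwiseDisjoint fun i => Metric.closedBall (c i) (ρ i)) :
    ∑ i ∈ F, ν (Metric.closedBall (c i) (ρ i)) * μ i (Metric.ball x r) ≤
      ENNReal.ofReal (M * 3 ^ Module.finrank ℝ E * (vol (Metric.ball 0 1)).toReal *
        r ^ (Module.finrank ℝ E : ℝ) + M * 3 ^ Module.finrank ℝ E * C * r ^ s) := by
  set n := Module.finrank ℝ E with hn
  have hb0 : vol (Metric.ball (0 : E) r) ≠ 0 := (Metric.measure_ball_pos _ _ hr).ne'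
  have hbt : vol (Metric.ball (0 : E) r) ≠ ∞ := measure_ball_lt_top.ne
  have hbr : vol (Metric.ball (0 : E) r) =
      ENNReal.ofReal (r ^ n * (vol (Metric.ball 0 1)).toReal) := by
    rw [Measure.addHaar_ball_of_pos _ _ hr, ENNReal.ofReal_mul (by positivity),
      ENNReal.ofReal_toReal measure_ball_lt_top.ne]
  have hb3 : vol (Metric.ball x (3 * r)) = 3 ^ n * vol (Metric.ball 0 r) := by
    rw [Measure.addHaar_ball_of_pos _ _ hr, Measure.addHaar_ball_of_pos _ _ (by positivity),
      mul_pow, ENNReal.ofReal_mul (by positivity), ENNReal.ofReal_pow (by positivity), mul_assoc]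
    simp [hn]
  set k : ℝ≥0∞ := M + M * (ENNReal.ofReal (C * r ^ s) / vol (Metric.ball 0 r)) with hk
  calc ∑ i ∈ F, ν (Metric.closedBall (c i) (ρ i)) * μ i (Metric.ball x r)
      ≤ ∑ i ∈ F, k * vol (Metric.closedBall (c i) (ρ i) ∩ Metric.ball x (3 * r)) :=
        Finset.sum_le_sum fun i _ => mul_measure_ball_le_mul_inter vol hr
          (hν _ measurableSet_closedBall) (hμ1 i) (hμc i) (hμ i)
    _ = k * vol (⋃ i ∈ F, Metric.closedBall (c i) (ρ i) ∩ Metric.ball x (3 * r)) := by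
        rw [← Finset.mul_sum, measure_biUnion_finset]
        · exact hF.mono fun i => inter_subset_left
        · exact fun i _ => measurableSet_closedBall.inter measurableSet_ball
    _ ≤ k * vol (Metric.ball x (3 * r)) := by
        gcongr
        exact iUnion₂_subset fun i _ => inter_subset_right
    _ = M * 3 ^ n * vol (Metric.ball 0 r) + M * 3 ^ n *
          (ENNReal.ofReal (C * r ^ s) / vol (Metric.ball 0 r) * vol (Metric.ball 0 r)) := by
        rw [hb3, hk]; ring
    _ = M * 3 ^ n * vol (Metric.ball 0 r) + M * 3 ^ n * ENNReal.ofReal (C * r ^ s) := by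
        rw [ENNReal.div_mul_cancel hb0 hbt]
    _ = _ := by
        have hM : (M : ℝ≥0∞) * 3 ^ n = ENNReal.ofReal (M * 3 ^ n) := by
          rw [ENNReal.ofReal_mul M.coe_nonneg, ENNReal.ofReal_coe_nnreal,
            ENNReal.ofReal_pow (by norm_num)]
          simp
        rw [hM, hbr, ← ENNReal.ofReal_mul (by positivity), ← ENNReal.ofReal_mul (by positivity),
          ← ENNReal.ofReal_add (by positivity) (by positivity), Real.rpow_natCast]
        congr 1
        ring

/-! ### The redistribution step. -/

/-- Absolute continuity turns a Vitali cover for `vol` into one for `ν`. The strict inequality `1 <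
ν univ` is what allows truncation to a finite family, whose union of closures is again compact. -/
theorem exists_finset_pairwiseDisjoint_one_lt_sum (vol : Measure E) [vol.IsAddHaarMeasure]
    {ν : Measure E} {c : ℕ → E} {ρ : ℕ → ℝ} (hρ : ∀ i, 0 < ρ i) (hρ0 : Tendsto ρ atTop (𝓝 0))
    {U : Set E} (hU : IsOpen U)
    (hfull : vol (U \ limsup (fun i => Metric.closedBall (c i) (ρ i)) atTop) = 0)
    (hν : ν ≪ vol) (hνU : ν Uᶜ = 0) (hν1 : 1 < ν univ) {δ : ℝ} (hδ : 0 < δ) (N : ℕ) :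
    ∃ F : Finset ℕ, (∀ i ∈ F, N ≤ i ∧ ρ i ≤ δ ∧ Metric.closedBall (c i) (ρ i) ⊆ U) ∧
      (F : Set ℕ).PairwiseDisjoint (fun i => Metric.closedBall (c i) (ρ i)) ∧
      1 < ∑ i ∈ F, ν (Metric.closedBall (c i) (ρ i)) := by
  set L := limsup (fun i => Metric.closedBall (c i) (ρ i)) atTop with hL
  obtain ⟨u, hut, huc, hud, hu0⟩ := exists_pairwiseDisjoint_closedBall_covering_ae vol (U ∩ L)
    {i | N ≤ i ∧ ρ i ≤ δ ∧ Metric.closedBall (c i) (ρ i) ⊆ U} c ρ (fun i _ => hρ i)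
    (fun x hx ε hε => by
      obtain ⟨η, hη, hηU⟩ := Metric.isOpen_iff.1 hU x hx.1
      have hfreq := mem_limsup_iff_frequently_mem.1 hx.2
      have hev : ∀ᶠ i in atTop, N ≤ i ∧ ρ i < min (min ε δ) (η / 2) :=
        (eventually_ge_atTop N).and (hρ0.eventually (gt_mem_nhds (by positivity)))
      obtain ⟨i, hxi, hNi, hi⟩ := (hfreq.and_eventually hev).exists
      simp only [lt_min_iff] at hi
      refine ⟨i, ⟨hNi, hi.1.2.le, fun y hy => hηU ?_⟩, hi.1.1.le, hxi⟩
      have h1 := Metric.mem_closedBall'.1 hxi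
      have h2 := Metric.mem_closedBall.1 hy
      have h3 := dist_triangle y (c i) x
      rw [dist_comm (c i) x] at h3
      rw [Metric.mem_ball]
      rw [dist_comm (c i) x] at h1
      linarith)
  have hle : ν univ ≤ ν (⋃ i ∈ u, Metric.closedBall (c i) (ρ i)) := by
    have hsub : (univ : Set E) ⊆ (⋃ i ∈ u, Metric.closedBall (c i) (ρ i)) ∪
        (Uᶜ ∪ ((U \ L) ∪ ((U ∩ L) \ ⋃ i ∈ u, Metric.closedBall (c i) (ρ i)))) := by
      intro x _
      by_cases h1 : x ∈ U <;> by_cases h2 : x ∈ L <;>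
        by_cases h3 : x ∈ ⋃ i ∈ u, Metric.closedBall (c i) (ρ i)
      all_goals simp only [mem_union, Set.mem_sdiff, mem_inter_iff, mem_compl_iff]; tauto
    refine (measure_mono hsub).trans ((measure_union_le _ _).trans ?_)
    rw [measure_union_null hνU (measure_union_null (hν hfull) (hν hu0)), add_zero]
  have h1 := (hν1.trans_le hle).trans_le (measure_biUnion_le ν huc _)
  rw [ENNReal.tsum_eq_iSup_sum, lt_iSup_iff] at h1
  obtain ⟨F, hF⟩ := h1
  refine ⟨F.map (Function.Embedding.subtype _), ?_, ?_, ?_⟩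
  · intro i hi
    obtain ⟨j, _, rfl⟩ := Finset.mem_map.1 hi
    exact hut j.2
  · refine hud.subset fun i hi => ?_
    obtain ⟨j, _, rfl⟩ := Finset.mem_map.1 (Finset.mem_coe.1 hi)
    exact j.2
  · rwa [Finset.sum_map]

/-- One step of the construction: the mass of `ν` in finitely many small disjoint balls is
redistributed by the measures `μ i`. -/
theorem IsFrostmanOn.exists_refinement (vol : Measure E) [vol.IsAddHaarMeasure]
    {c : ℕ → E} {ρ : ℕ → ℝ} (hρ : ∀ i, 0 < ρ i) (hρ0 : Tendsto ρ atTop (𝓝 0))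
    {V : ℕ → Set E} (hV : ∀ i, IsOpen (V i)) (hVc : ∀ i, IsCompact (closure (V i)))
    (hVb : ∀ i, closure (V i) ⊆ Metric.closedBall (c i) (ρ i))
    {μ : ℕ → Measure E} (hμ1 : ∀ i, μ i univ = 1) (hμV : ∀ i, μ i (V i)ᶜ = 0)
    (hμM : ∀ i, ∃ M : ℝ≥0, ∀ T, MeasurableSet T → μ i T ≤ M * vol T)
    {s t C : ℝ} (hC : 0 ≤ C)
    (hμ : ∀ i x r, 0 < r → vol (Metric.closedBall (c i) (ρ i)) * μ i (Metric.ball x r) ≤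
      ENNReal.ofReal (C * r ^ s))
    (ht : 0 < t) (hts : t < s) (htd : t < Module.finrank ℝ E)
    {U : Set E} (hU : IsOpen U)
    (hfull : vol (U \ limsup (fun i => Metric.closedBall (c i) (ρ i)) atTop) = 0)
    {A A' : ℝ} (hA : 0 < A) (hAA' : A < A') {ν : Measure E} (hν : IsFrostmanOn vol t A U ν)
    (N : ℕ) :
    ∃ U', IsOpen U' ∧ IsCompact (closure U') ∧ closure U' ⊆ U ∧
      (∀ x ∈ closure U', ∃ i ≥ N, x ∈ closure (V i)) ∧ ∃ ν', IsFrostmanOn vol t A' U' ν' := by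
  obtain ⟨M, hM⟩ := hν.exists_le
  have hac : ν ≪ vol := .mk fun T hT h0 => by simpa [h0] using hM T hT
  -- The order matters: `δ` depends on the density bound `M`, then `ε` on `δ`, and only then are
  -- balls of radius at most `ε` selected.
  obtain ⟨δ, hδ, hsmall⟩ := exists_forall_lt_add_rpow_le
    (a := M * 3 ^ Module.finrank ℝ E * (vol (Metric.ball 0 1)).toReal)
    (b := M * 3 ^ Module.finrank ℝ E * C) htd hts hA
  obtain ⟨ε, hε, hlarge⟩ := exists_forall_ge_add_rpow_le ht hA hAA' hδ
  obtain ⟨F, hF, hFd, hF1⟩ := exists_finset_pairwiseDisjoint_one_lt_sum vol hρ hρ0 hU hfull hac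
    hν.compl_eq_zero hν.one_lt hε N
  have hμc : ∀ i, μ i (Metric.closedBall (c i) (ρ i))ᶜ = 0 := fun i =>
    measure_mono_null (compl_subset_compl.2 (subset_closure.trans (hVb i))) (hμV i)
  have hcl : closure (⋃ i ∈ F, V i) = ⋃ i ∈ F, closure (V i) :=
    F.finite_toSet.closure_biUnion _
  have happ : ∀ T, (∑ i ∈ F, ν (Metric.closedBall (c i) (ρ i)) • μ i) T =
      ∑ i ∈ F, ν (Metric.closedBall (c i) (ρ i)) * μ i T := fun T => by
    simp [Measure.finsetSum_apply]
  refine ⟨⋃ i ∈ F, V i, isOpen_biUnion fun i _ => hV i, ?_, ?_, ?_,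
    ∑ i ∈ F, ν (Metric.closedBall (c i) (ρ i)) • μ i, ?_, ?_, ?_, ?_⟩
  · rw [hcl]
    exact F.isCompact_biUnion fun i _ => hVc i
  · rw [hcl]
    exact iUnion₂_subset fun i hi => (hVb i).trans (hF i hi).2.2
  · intro x hx
    rw [hcl, mem_iUnion₂] at hx
    obtain ⟨i, hi, hxi⟩ := hx
    exact ⟨i, (hF i hi).1, hxi⟩
  · choose M' hM' using hμM
    refine ⟨∑ i ∈ F, (M * vol (Metric.closedBall (c i) (ρ i))).toNNReal * M' i, fun T hT => ?_⟩
    rw [happ, ENNReal.ofNNReal_finsetSum, Finset.sum_mul]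
    refine Finset.sum_le_sum fun i _ => ?_
    rw [ENNReal.coe_mul, ENNReal.coe_toNNReal
      (ENNReal.mul_ne_top ENNReal.coe_ne_top measure_closedBall_lt_top.ne), mul_assoc]
    exact mul_le_mul' (hM _ measurableSet_closedBall) (hM' i T hT)
  · rw [happ]
    refine Finset.sum_eq_zero fun i hi => ?_
    rw [measure_mono_null (compl_subset_compl.2 (subset_iUnion₂_of_subset i hi subset_rfl)) (hμV i), mul_zero]
  · rw [happ]
    simpa [hμ1] using hF1
  · intro x r hr
    rw [happ]
    rcases lt_or_ge r δ with hrδ | hrδ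
    · refine (sum_mul_measure_ball_le vol hr hC hM hμ1 hμc (fun i => hμ i x r hr) hFd).trans
        (ENNReal.ofReal_le_ofReal ((hsmall r hr hrδ).trans ?_))
      gcongr
    -- At these scales the position of mass inside a selected ball is irrelevant: a ball meeting
    -- `ball x r` lies in `ball x (r + 2 * ε)`.
    · calc ∑ i ∈ F, ν (Metric.closedBall (c i) (ρ i)) * μ i (Metric.ball x r)
          ≤ ∑ i ∈ F, ν (Metric.closedBall (c i) (ρ i) ∩ Metric.ball x (r + 2 * ε)) := by
            refine Finset.sum_le_sum fun i hi => ?_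
            rcases (Metric.closedBall (c i) (ρ i) ∩ Metric.ball x r).eq_empty_or_nonempty
              with he | ⟨y, hyc, hyx⟩
            · have : μ i (Metric.ball x r) = 0 :=
                measure_mono_null (fun z hz hzc => (he.subset ⟨hzc, hz⟩ : z ∈ (∅ : Set E)))
                  (hμc i)
              simp [this]
            · rw [inter_eq_left.2 fun z hz => ?_]
              · calc ν (Metric.closedBall (c i) (ρ i)) * μ i (Metric.ball x r)
                    ≤ ν (Metric.closedBall (c i) (ρ i)) * 1 :=
                      mul_le_mul' le_rfl (hμ1 i ▸ measure_mono (subset_univ _))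
                  _ = _ := mul_one _
              · have h1 := Metric.mem_closedBall.1 hz
                have h2 := Metric.mem_closedBall'.1 hyc
                have h3 := Metric.mem_ball.1 hyx
                have h4 := dist_triangle4 z (c i) y x
                have h5 := (hF i hi).2.1
                rw [Metric.mem_ball]
                linarith
        _ = ν (⋃ i ∈ F, Metric.closedBall (c i) (ρ i) ∩ Metric.ball x (r + 2 * ε)) := by
            rw [measure_biUnion_finset]
            · exact hFd.mono fun i => inter_subset_left
            · exact fun i _ => measurableSet_closedBall.inter measurableSet_ball
        _ ≤ ν (Metric.ball x (r + 2 * ε)) :=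
            measure_mono (iUnion₂_subset fun i _ => inter_subset_right)
        _ ≤ ENNReal.ofReal (A * (r + 2 * ε) ^ t) := hν.ball_le x _ (by positivity)
        _ ≤ _ := ENNReal.ofReal_le_ofReal (hlarge r hrδ)

end

/-! ### Consequences of the lower bound on `singularValueFun`. -/

/-- The supremum need not be attained, so a measure is chosen for `a / 2`; this accounts for `4` in
place of `2`. -/
theorem exists_isCompact_measure_of_le_singularValueFun {X : Type*} [MetricSpace X]
    [ProperSpace X] [MeasurableSpace X] [BorelSpace X] {s : ℝ} {O : Set X} (hO : IsOpen O)
    {a : ℝ≥0∞} (ha0 : a ≠ 0) (hat : a ≠ ∞) (h : a ≤ singularValueFun s O) :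
    ∃ K ⊆ O, IsCompact K ∧ ∃ μ : Measure X, IsProbabilityMeasure μ ∧ μ Kᶜ = 0 ∧
      ∀ x, ∀ r : ℝ, 0 < r → a * μ (Metric.ball x r) ≤ ENNReal.ofReal (4 * 2 ^ s * r ^ s) := by
  obtain ⟨μ, hμ, hμO, hμs⟩ :=
    exists_measure_of_lt_singularValueFun ((ENNReal.half_lt_self ha0 hat).trans_le h)
  obtain ⟨K, hKO, hK, ν, hν, hνK, hνs⟩ := exists_isCompact_measure_of_frostman hO μ hμO hμs
  refine ⟨K, hKO, hK, ν, hν, hνK, fun x r hr => ?_⟩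
  calc a * ν (Metric.ball x r) = 2 * (a / 2 * ν (Metric.ball x r)) := by
        rw [← mul_assoc, ENNReal.mul_div_cancel two_ne_zero ENNReal.ofNat_ne_top]
    _ ≤ 2 * ENNReal.ofReal (2 * 2 ^ s * r ^ s) := by gcongr; exact hνs x r hr
    _ = ENNReal.ofReal (4 * 2 ^ s * r ^ s) := by
        rw [← ENNReal.ofReal_ofNat 2, ← ENNReal.ofReal_mul zero_le_two]
        congr 1
        ring

/-- Applied to a single `E i`, this forces `s ≤ d`. -/
theorem le_dimH_of_isCompact_measure {X : Type*} [MetricSpace X] [MeasurableSpace X]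
    [BorelSpace X] {s C : ℝ} (hs : 0 < s) (hC : 0 < C) {a : ℝ≥0∞} (ha0 : a ≠ 0) (hat : a ≠ ∞)
    {K : Set X} (μ : Measure X) [IsProbabilityMeasure μ] (hμK : μ Kᶜ = 0)
    (hμ : ∀ x, ∀ r : ℝ, 0 < r → a * μ (Metric.ball x r) ≤ ENNReal.ofReal (C * r ^ s)) :
    ENNReal.ofReal s ≤ dimH K := by
  have ha : 0 < a.toReal := ENNReal.toReal_pos ha0 hat
  refine le_dimH_of_forall_isOpen_exists_measure (A := C / a.toReal) hs (by positivity)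
    fun W hW hKW => ⟨μ, ?_, fun x r hr => ?_⟩
  · exact ((prob_compl_eq_zero_iff hW.measurableSet).1
      (measure_mono_null (compl_subset_compl.2 hKW) hμK)).ge
  · rw [div_mul_eq_mul_div, ENNReal.ofReal_div_of_pos ha, ENNReal.ofReal_toReal hat,
      ENNReal.le_div_iff_mul_le (Or.inl ha0) (Or.inl hat), mul_comm]
    exact hμ x r hr

/-! ### Iteration and the Hausdorff dimension bound. -/

section

variable {E : Type*} [NormedAddCommGroup E] [MeasurableSpace E]
variable [NormedSpace ℝ E] [FiniteDimensional ℝ E] [BorelSpace E]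

theorem IsFrostmanOn.le_dimH_limsup (vol : Measure E) [vol.IsAddHaarMeasure]
    {c : ℕ → E} {ρ : ℕ → ℝ} (hρ : ∀ i, 0 < ρ i) (hρ0 : Tendsto ρ atTop (𝓝 0))
    {V : ℕ → Set E} (hV : ∀ i, IsOpen (V i)) (hVc : ∀ i, IsCompact (closure (V i)))
    (hVb : ∀ i, closure (V i) ⊆ Metric.closedBall (c i) (ρ i))
    {μ : ℕ → Measure E} (hμ1 : ∀ i, μ i univ = 1) (hμV : ∀ i, μ i (V i)ᶜ = 0)
    (hμM : ∀ i, ∃ M : ℝ≥0, ∀ T, MeasurableSet T → μ i T ≤ M * vol T)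
    {s t C : ℝ} (hC : 0 ≤ C)
    (hμ : ∀ i x r, 0 < r → vol (Metric.closedBall (c i) (ρ i)) * μ i (Metric.ball x r) ≤
      ENNReal.ofReal (C * r ^ s))
    (ht : 0 < t) (hts : t < s) (htd : t < Module.finrank ℝ E)
    {U₀ : Set E} (hU₀ : IsOpen U₀)
    (hfull : vol (U₀ \ limsup (fun i => Metric.closedBall (c i) (ρ i)) atTop) = 0)
    {A : ℝ} (hA : 0 < A) {ν : Measure E} (hν : IsFrostmanOn vol t A U₀ ν) :
    ENNReal.ofReal t ≤ dimH (limsup (fun i => closure (V i)) atTop) := by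
  let P : Set E → Prop := fun U => IsOpen U ∧ U ⊆ U₀ ∧
    ∃ A', 0 < A' ∧ A' < A + 1 ∧ ∃ ν, IsFrostmanOn vol t A' U ν
  have hstep : ∀ (U : {U // P U}) (N : ℕ), ∃ U' : {U // P U}, IsCompact (closure U'.1) ∧
      closure U'.1 ⊆ U.1 ∧ ∀ x ∈ closure U'.1, ∃ i ≥ N, x ∈ closure (V i) := by
    rintro ⟨U, hU, hUU₀, A', hA', hA'A, ν, hν⟩ N
    -- Each stage increases the constant strictly but stays below `A + 1`, so one constant serves
    -- all stages.
    obtain ⟨A'', hA'', hA''A⟩ := exists_between hA'A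
    obtain ⟨U', h1, h2, h3, h4, ν', hν'⟩ := hν.exists_refinement vol hρ hρ0 hV hVc hVb hμ1 hμV hμM
      hC hμ ht hts htd hU (measure_mono_null (sdiff_subset_sdiff_left hUU₀) hfull) hA' hA'' N
    exact ⟨⟨U', h1, (subset_closure.trans h3).trans hUU₀, A'', hA'.trans hA'', hA''A, ν', hν'⟩,
      h2, h3, h4⟩
  choose next hnc hns hni using hstep
  let U : ℕ → {U // P U} := fun n =>
    Nat.rec ⟨U₀, hU₀, subset_rfl, A, hA, by linarith, ν, hν⟩ (fun n W => next W n) n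
  have hUs : ∀ n, U (n + 1) = next (U n) n := fun n => rfl
  have hsub : (⋂ n, closure (U (n + 1)).1) ⊆ limsup (fun i => closure (V i)) atTop := by
    intro x hx
    rw [mem_limsup_iff_frequently_mem, frequently_atTop]
    intro N
    have := mem_iInter.1 hx N
    rw [hUs] at this
    exact hni _ _ x this
  refine le_trans ?_ (dimH_mono hsub)
  refine le_dimH_of_forall_isOpen_exists_measure (A := A + 1) ht (by linarith) fun W hW hKW => ?_
  have hanti : Antitone fun n => closure (U (n + 1)).1 := antitone_nat_of_succ_le fun n => by
    rw [hUs (n + 1)]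
    exact (hns _ _).trans subset_closure
  -- Compactness puts a whole stage inside `W`; the measure of that stage is the one required.
  obtain ⟨n, hn⟩ := exists_subset_nhds_of_isCompact hanti.directed_ge
    (fun n => by rw [hUs]; exact hnc _ _) (fun x hx => hW.mem_nhds (hKW hx))
  obtain ⟨A', -, hA', ν', hν'⟩ := (U (n + 1)).2.2.2
  refine ⟨ν', ?_, fun x r hr => (hν'.ball_le x r hr).trans (ENNReal.ofReal_le_ofReal ?_)⟩
  · calc 1 ≤ ν' univ := hν'.one_lt.le
      _ ≤ ν' W + ν' Wᶜ := by rw [← union_compl_self W]; exact measure_union_le _ _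
      _ = ν' W := by
        rw [measure_mono_null (compl_subset_compl.2 (subset_closure.trans hn))
          hν'.compl_eq_zero, add_zero]
  · gcongr

/-- The initial measure; the factor `2` makes its mass exceed `1`. In the constant, `2 * vol (ball 0
1)` handles `r ≤ 1` and the total mass `2` handles `r ≥ 1`. -/
theorem isFrostmanOn_two_smul_restrict (vol : Measure E) [vol.IsAddHaarMeasure] {U : Set E}
    (hU : IsOpen U) (hU1 : vol U = 1) {t : ℝ} (ht : 0 ≤ t) (htd : t ≤ Module.finrank ℝ E) :
    IsFrostmanOn vol t (2 + 2 * (vol (Metric.ball 0 1)).toReal) U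
      ((2 : ℝ≥0∞) • vol.restrict U) where
  exists_le := ⟨2, fun T _ => by
    rw [Measure.smul_apply, smul_eq_mul]
    exact mul_le_mul' le_rfl (Measure.restrict_apply_le _ _)⟩
  compl_eq_zero := by
    rw [Measure.smul_apply, Measure.restrict_apply hU.measurableSet.compl]
    simp
  one_lt := by
    rw [Measure.smul_apply, Measure.restrict_apply_univ, hU1]
    simp
  ball_le x r hr := by
    set ω := (vol (Metric.ball (0 : E) 1)).toReal with hω
    have hω0 : 0 ≤ ω := ENNReal.toReal_nonneg
    have hrt : 0 < r ^ t := Real.rpow_pos_of_pos hr t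
    rw [Measure.smul_apply, smul_eq_mul]
    rcases le_total r 1 with h1 | h1
    · calc 2 * vol.restrict U (Metric.ball x r) ≤ 2 * vol (Metric.ball x r) :=
            mul_le_mul' le_rfl (Measure.restrict_apply_le _ _)
        _ = ENNReal.ofReal (2 * ω * r ^ (Module.finrank ℝ E : ℝ)) := by
            rw [Measure.addHaar_ball_of_pos _ _ hr, ← ENNReal.ofReal_toReal
              (measure_ball_lt_top (μ := vol) (x := (0 : E)) (r := 1)).ne, ← hω,
              ← ENNReal.ofReal_mul (by positivity), ← ENNReal.ofReal_ofNat 2,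
              ← ENNReal.ofReal_mul zero_le_two, Real.rpow_natCast]
            congr 1
            ring
        _ ≤ _ := by
            apply ENNReal.ofReal_le_ofReal
            have := Real.rpow_le_rpow_of_exponent_ge hr h1 htd
            have := mul_le_mul_of_nonneg_left this (by positivity : 0 ≤ 2 * ω)
            linarith
    · calc 2 * vol.restrict U (Metric.ball x r) ≤ 2 * vol.restrict U univ :=
            mul_le_mul' le_rfl (measure_mono (subset_univ _))
        _ = ENNReal.ofReal 2 := by rw [Measure.restrict_apply_univ, hU1]; simp
        _ ≤ _ := by
            apply ENNReal.ofReal_le_ofReal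
            have : 1 ≤ r ^ t := Real.one_le_rpow h1 ht
            nlinarith [mul_nonneg hω0 hrt.le]

end

/-! ### Packing dimension and Baire category. -/

theorem packingPremeasure_empty {X : Type*} [PseudoMetricSpace X] (p : ℝ≥0) :
    packingPremeasure p (∅ : Set X) = 0 := by
  refine le_antisymm ((iInf₂_le 1 one_pos).trans (iSup₂_le fun P hP => ?_)) bot_le
  have : P = ∅ := eq_empty_of_forall_notMem fun q hq => (hP.2.1 q hq).1
  subst this
  simp

theorem packingMeasure_le_packingPremeasure {X : Type*} [PseudoMetricSpace X] (p : ℝ≥0)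
    (A : Set X) : packingMeasure p A ≤ packingPremeasure p A := by
  refine (iInf₂_le (fun n : ℕ => if n = 0 then A else ∅)
    (fun x hx => mem_iUnion.2 ⟨0, by simpa using hx⟩)).trans ?_
  rw [tsum_eq_single 0 fun n hn => by simp [hn, packingPremeasure_empty]]
  simp

/-- Baire category theorem relative to an open set: a countable cover of the
intersection of countably many open sets that are dense in `U` has a somewhere dense member. -/
theorem exists_interior_closure_nonempty_of_iInter_subset {X : Type*} [TopologicalSpace X]
    [BaireSpace X] {U : Set X} (hU : IsOpen U) (hne : U.Nonempty) {O F : ℕ → Set X}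
    (hO : ∀ n, IsOpen (O n)) (hUO : ∀ n, U ⊆ closure (O n)) (hF : ⋂ n, O n ⊆ ⋃ n, F n) :
    ∃ n, (interior (closure (F n))).Nonempty := by
  by_contra! hcon
  -- Adding the exterior of `U` makes the sets dense in the whole space without changing them inside
  -- `U`.
  have hd : ∀ n, Dense (O n ∪ (closure U)ᶜ) := fun n x => by
    by_cases hx : x ∈ closure U
    · exact closure_mono subset_union_left (closure_minimal (hUO n) isClosed_closure hx)
    · exact subset_closure (Or.inr hx)
  have ho : ∀ n, IsOpen (O n ∪ (closure U)ᶜ) := fun n =>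
    (hO n).union isClosed_closure.isOpen_compl
  have hdense : Dense (⋂ n, (O n ∪ (closure U)ᶜ) ∩ (closure (F n))ᶜ) :=
    dense_iInter_of_isOpen_nat (fun n => (ho n).inter isClosed_closure.isOpen_compl) fun n =>
      (hd n).inter_of_isOpen_left (interior_eq_empty_iff_dense_compl.1 (hcon n)) (ho n)
  obtain ⟨x, hxU, hx⟩ := hdense.inter_open_nonempty U hU hne
  rw [mem_iInter] at hx
  obtain ⟨n, hn⟩ := mem_iUnion.1 (hF (mem_iInter.2 fun n =>
    (hx n).1.resolve_right fun h => h (subset_closure hxU)))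
  exact (hx n).2 (subset_closure hn)

section

variable {E : Type*} [NormedAddCommGroup E]
variable [NormedSpace ℝ E] [FiniteDimensional ℝ E]

/-- For `r ≤ 1` and `p` at least the dimension, `(2 r)^p` is at most a constant times the volume of
the ball, and the disjoint balls lie in the bounded set `cthickening 1 A`. -/
theorem packingPreSup_one_ne_top {p : ℝ≥0} (hp : (Module.finrank ℝ E : ℝ) ≤ p)
    {A : Set E} (hA : Bornology.IsBounded A) : packingPreSup p 1 A ≠ ∞ := by
  borelize E
  let vol : Measure E := Measure.addHaar
  have hω0 : vol (Metric.ball (0 : E) 1) ≠ 0 := (Metric.measure_ball_pos _ _ one_pos).ne'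
  have hωt : vol (Metric.ball (0 : E) 1) ≠ ∞ := measure_ball_lt_top.ne
  have hbd : ENNReal.ofReal (2 ^ (p : ℝ)) / vol (Metric.ball 0 1) *
      vol (Metric.cthickening 1 A) ≠ ∞ :=
    ENNReal.mul_ne_top (ENNReal.div_ne_top ENNReal.ofReal_ne_top hω0)
      hA.cthickening.measure_lt_top.ne
  refine ne_top_of_le_ne_top hbd (iSup₂_le fun P hP => ?_)
  calc ∑' q : P, ENNReal.ofReal ((2 * (q : E × ℝ).2) ^ (p : ℝ))
      ≤ ∑' q : P, ENNReal.ofReal (2 ^ (p : ℝ)) / vol (Metric.ball 0 1) *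
          vol (Metric.closedBall (q : E × ℝ).1 (q : E × ℝ).2) := by
        refine ENNReal.tsum_le_tsum fun q => ?_
        obtain ⟨-, h0, h1⟩ := hP.2.1 q q.2
        rw [Measure.addHaar_closedBall _ _ h0.le, mul_comm (ENNReal.ofReal (_ ^ _)) (vol _),
          ← mul_assoc, ENNReal.div_mul_cancel hω0 hωt, ← ENNReal.ofReal_mul (by positivity)]
        apply ENNReal.ofReal_le_ofReal
        rw [Real.mul_rpow zero_le_two h0.le, ← Real.rpow_natCast]
        exact mul_le_mul_of_nonneg_left (Real.rpow_le_rpow_of_exponent_ge h0 h1 hp)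
          (by positivity)
    _ = ENNReal.ofReal (2 ^ (p : ℝ)) / vol (Metric.ball 0 1) *
          vol (⋃ q ∈ P, Metric.closedBall q.1 q.2) := by
        rw [ENNReal.tsum_mul_left, measure_biUnion hP.1 hP.2.2
          fun _ _ => Metric.isClosed_closedBall.measurableSet]
    _ ≤ _ := by
        gcongr
        refine iUnion₂_subset fun q hq => ?_
        obtain ⟨hqA, -, h1⟩ := hP.2.1 q hq
        exact (Metric.closedBall_subset_closedBall h1).trans
          (Metric.closedBall_subset_cthickening hqA 1)

theorem packingDim_le_finrank {A : Set E} (hA : Bornology.IsBounded A) :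
    packingDim A ≤ Module.finrank ℝ E := by
  refine iSup₂_le fun p hp => ?_
  by_contra! hlt
  have hlt' : (Module.finrank ℝ E : ℝ) ≤ p := by exact_mod_cast hlt.le
  exact packingPreSup_one_ne_top hlt' hA (top_le_iff.1
    (hp.ge.trans ((packingMeasure_le_packingPremeasure p A).trans (iInf₂_le 1 one_pos))))

/-- Balls centred in `F` of radius at most `ε` can be packed to fill almost all of `interior
(closure F)`. Since `p - n < 0`, each satisfies `(2 r)^p ≥ (2 ε)^(p - n) r^n`, so the sum is at
least a fixed multiple of `(2 ε)^(p - n)`, which tends to infinity. -/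
theorem packingPremeasure_eq_top {p : ℝ≥0} (hp : (p : ℝ) < Module.finrank ℝ E) {F : Set E}
    (hF : (interior (closure F)).Nonempty) : packingPremeasure p F = ∞ := by
  borelize E
  let vol : Measure E := Measure.addHaar
  set n := Module.finrank ℝ E with hn
  set W := interior (closure F) with hW
  have hωt : vol (Metric.ball (0 : E) 1) ≠ ∞ := measure_ball_lt_top.ne
  have hW0 : vol W ≠ 0 := (isOpen_interior.measure_pos _ hF).ne'
  rw [packingPremeasure, ← top_le_iff]
  refine le_iInf₂ fun δ hδ => ?_
  have key : ∀ ε, 0 < ε → ε ≤ δ → ENNReal.ofReal ((2 * ε) ^ ((p : ℝ) - n)) * vol W ≤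
      packingPreSup p δ F * vol (Metric.ball 0 1) := by
    intro ε hε hεδ
    obtain ⟨u, hut, huc, hud, hu0⟩ := exists_pairwiseDisjoint_closedBall_covering_ae vol W
      {q : E × ℝ | q.1 ∈ F ∧ 0 < q.2 ∧ q.2 ≤ ε} Prod.fst Prod.snd (fun q hq => hq.2.1)
      (fun x hx η hη => by
        obtain ⟨y, hyF, hxy⟩ := Metric.mem_closure_iff.1 (interior_subset hx) (min ε η)
          (by positivity)
        exact ⟨(y, min ε η), ⟨hyF, by positivity, min_le_left _ _⟩, min_le_right _ _,
          Metric.mem_closedBall.2 hxy.le⟩)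
    have hP : IsBallPacking δ F u :=
      ⟨huc, fun q hq => ⟨(hut hq).1, (hut hq).2.1, (hut hq).2.2.trans hεδ⟩, hud⟩
    calc ENNReal.ofReal ((2 * ε) ^ ((p : ℝ) - n)) * vol W
        ≤ ENNReal.ofReal ((2 * ε) ^ ((p : ℝ) - n)) *
            vol (⋃ q ∈ u, Metric.closedBall q.1 q.2) := by
          exact mul_le_mul' le_rfl (measure_mono_ae (ae_le_set.2 hu0))
      _ = ∑' q : u, ENNReal.ofReal ((2 * ε) ^ ((p : ℝ) - n)) *
            vol (Metric.closedBall (q : E × ℝ).1 (q : E × ℝ).2) := by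
          rw [ENNReal.tsum_mul_left, measure_biUnion huc hud
            fun _ _ => Metric.isClosed_closedBall.measurableSet]
      _ ≤ ∑' q : u, ENNReal.ofReal ((2 * (q : E × ℝ).2) ^ (p : ℝ)) * vol (Metric.ball 0 1) := by
          refine ENNReal.tsum_le_tsum fun q => ?_
          obtain ⟨-, h0, h1⟩ := hut q.2
          rw [Measure.addHaar_closedBall _ _ h0.le, ← mul_assoc,
            ← ENNReal.ofReal_mul (by positivity)]
          refine mul_le_mul' (ENNReal.ofReal_le_ofReal ?_) le_rfl
          have h2 : (2 * ε) ^ ((p : ℝ) - n) ≤ (2 * (q : E × ℝ).2) ^ ((p : ℝ) - n) :=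
            Real.rpow_le_rpow_of_nonpos (by positivity) (by linarith) (by linarith)
          have h3 : (q : E × ℝ).2 ^ n ≤ (2 * (q : E × ℝ).2) ^ (n : ℝ) := by
            rw [Real.rpow_natCast]
            gcongr
            linarith
          calc (2 * ε) ^ ((p : ℝ) - n) * (q : E × ℝ).2 ^ n
              ≤ (2 * (q : E × ℝ).2) ^ ((p : ℝ) - n) * (2 * (q : E × ℝ).2) ^ (n : ℝ) := by
                gcongr
            _ = (2 * (q : E × ℝ).2) ^ (p : ℝ) := by
                rw [← Real.rpow_add (by positivity), sub_add_cancel]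
      _ ≤ _ := by
          rw [ENNReal.tsum_mul_right]
          exact mul_le_mul' (le_iSup₂_of_le u hP le_rfl) le_rfl
  have hlim : Tendsto (fun ε : ℝ => ENNReal.ofReal ((2 * ε) ^ ((p : ℝ) - n)) * vol W)
      (𝓝[>] 0) (𝓝 ∞) := by
    have h1 : Tendsto (fun ε : ℝ => 2 * ε) (𝓝[>] 0) (𝓝[>] 0) := by
      refine tendsto_nhdsWithin_iff.2 ⟨?_, ?_⟩
      · have : Tendsto (fun ε : ℝ => 2 * ε) (𝓝 0) (𝓝 (2 * 0)) := tendsto_id.const_mul 2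
        rw [mul_zero] at this
        exact this.mono_left nhdsWithin_le_nhds
      · filter_upwards [self_mem_nhdsWithin] with ε hε
        exact mul_pos two_pos (mem_Ioi.1 hε)
    have h2 := ENNReal.tendsto_ofReal_atTop.comp
      ((tendsto_rpow_neg_nhdsGT_zero (by linarith : (p : ℝ) - n < 0)).comp h1)
    have h3 := ENNReal.Tendsto.mul_const (b := vol W) h2 (Or.inl ENNReal.top_ne_zero)
    rwa [ENNReal.top_mul hW0] at h3
  have htop : ∞ ≤ packingPreSup p δ F * vol (Metric.ball 0 1) := by
    refine le_of_tendsto hlim ?_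
    filter_upwards [Ioc_mem_nhdsGT hδ] with ε hε using key ε hε.1 hε.2
  rcases ENNReal.mul_eq_top.1 (top_le_iff.1 htop) with h | h
  · exact absurd h.2 hωt
  · exact h.1.ge

theorem finrank_le_packingDim {G : Set E}
    (hG : ∀ F : ℕ → Set E, G ⊆ ⋃ n, F n → ∃ n, (interior (closure (F n))).Nonempty) :
    (Module.finrank ℝ E : ℝ≥0∞) ≤ packingDim G := by
  refine le_of_forall_lt fun a ha => ?_
  obtain ⟨b, hab, hb⟩ := exists_between ha
  lift b to ℝ≥0 using hb.ne_top
  refine hab.trans_le (le_iSup₂_of_le b ?_ le_rfl)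
  rw [packingMeasure, ← top_le_iff]
  refine le_iInf₂ fun F hF => ?_
  obtain ⟨n, hn⟩ := hG F hF
  exact (ENNReal.tsum_eq_top_of_eq_top
    ⟨n, packingPremeasure_eq_top (by exact_mod_cast hb) hn⟩).ge

end

/-! ### Assembly of the theorem. -/

theorem IsOpenOrClosedBall.measurableSet {X : Type*} [PseudoMetricSpace X] [MeasurableSpace X]
    [OpensMeasurableSpace X] {B : Set X} (hB : IsOpenOrClosedBall B) : MeasurableSet B := by
  obtain ⟨c, r, -, rfl | rfl⟩ := hB
  · exact measurableSet_ball
  · exact measurableSet_closedBall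

theorem IsOpenOrClosedBall.exists_subset_closedBall {E : Type*} [NormedAddCommGroup E]
    [NormedSpace ℝ E] [FiniteDimensional ℝ E] [MeasurableSpace E] [BorelSpace E]
    [Nontrivial E] (vol : Measure E) [vol.IsAddHaarMeasure] {B : Set E}
    (hB : IsOpenOrClosedBall B) :
    ∃ c r, 0 < r ∧ B ⊆ Metric.closedBall c r ∧ Metric.diam B = 2 * r ∧
      vol B = vol (Metric.closedBall c r) := by
  obtain ⟨c, r, hr, rfl | rfl⟩ := hB
  · exact ⟨c, r, hr, Metric.ball_subset_closedBall, Metric.diam_ball_eq c hr.le,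
      (Measure.addHaar_closedBall_eq_addHaar_ball vol c r).symm⟩
  · exact ⟨c, r, hr, subset_rfl, Metric.diam_closedBall_eq c hr.le, rfl⟩

/-- Only nonemptiness of the `O i` matters, not their size: almost every point of `U` lies in
arbitrarily small balls of the sequence, each containing a point of its `O i`, so the tail unions
are dense in `U`. -/
theorem packingDim_limsup_eq {E : Type*} [NormedAddCommGroup E]
    [NormedSpace ℝ E] [FiniteDimensional ℝ E] [MeasurableSpace E] [BorelSpace E]
    (vol : Measure E) [vol.IsAddHaarMeasure] {c : ℕ → E} {ρ : ℕ → ℝ}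
    (hρ0 : Tendsto ρ atTop (𝓝 0)) {O : ℕ → Set E} (hO : ∀ i, IsOpen (O i))
    (hOne : ∀ i, (O i).Nonempty) (hOb : ∀ i, O i ⊆ Metric.closedBall (c i) (ρ i))
    {U : Set E} (hU : IsOpen U) (hne : U.Nonempty)
    (hfull : vol (U \ limsup (fun i => Metric.closedBall (c i) (ρ i)) atTop) = 0)
    (hbdd : Bornology.IsBounded (limsup O atTop)) :
    packingDim (limsup O atTop) = Module.finrank ℝ E := by
  refine le_antisymm (packingDim_le_finrank hbdd) (finrank_le_packingDim fun F hF =>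
    exists_interior_closure_nonempty_of_iInter_subset hU hne (O := fun n => ⋃ i ≥ n, O i)
      (fun n => isOpen_biUnion fun i _ => hO i) (fun n x hx => ?_) (Subset.trans ?_ hF))
  · refine Metric.mem_closure_iff.2 fun ε hε => ?_
    obtain ⟨y, hyL, hyx, hyU⟩ : (limsup (fun i => Metric.closedBall (c i) (ρ i)) atTop ∩
        (Metric.ball x (ε / 2) ∩ U)).Nonempty := by
      by_contra! hcon
      have h0 : vol (Metric.ball x (ε / 2) ∩ U) = 0 := by
        refine measure_mono_null (fun z hz => ?_) hfull
        exact ⟨hz.2, fun hzL => (hcon.subset ⟨hzL, hz⟩ : z ∈ (∅ : Set E))⟩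
      exact ((Metric.isOpen_ball.inter hU).measure_pos vol
        ⟨x, Metric.mem_ball_self (by positivity), hx⟩).ne' h0
    have hev : ∀ᶠ i in atTop, n ≤ i ∧ ρ i < ε / 4 :=
      (eventually_ge_atTop n).and (hρ0.eventually (gt_mem_nhds (by positivity)))
    obtain ⟨i, hyi, hni, hi⟩ :=
      ((mem_limsup_iff_frequently_mem.1 hyL).and_eventually hev).exists
    obtain ⟨z, hz⟩ := hOne i
    refine ⟨z, mem_iUnion₂.2 ⟨i, hni, hz⟩, ?_⟩
    have h1 := Metric.mem_closedBall.1 hyi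
    have h2 := Metric.mem_closedBall'.1 (hOb i hz)
    have h3 := Metric.mem_ball'.1 hyx
    have h4 := dist_triangle4 x y (c i) z
    linarith
  · intro x hx
    rw [mem_limsup_iff_frequently_mem, frequently_atTop]
    intro n
    obtain ⟨i, hi, hxi⟩ := mem_iUnion₂.1 (mem_iInter.1 hx n)
    exact ⟨i, hi, hxi⟩

theorem openUnitCube_nonempty (d : ℕ) : (openUnitCube d).Nonempty :=
  nonempty_of_measure_ne_zero (μ := volume) (by rw [volume_openUnitCube]; exact one_ne_zero)

theorem theorem3p2 (d : ℕ) (B E : ℕ → Set (EuclideanSpace ℝ (Fin d)))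
    (hBball : ∀ i, IsOpenOrClosedBall (B i))
    (hBcube : ∀ i, B i ⊆ unitCube d)
    (hBdiam : Tendsto (fun i => Metric.diam (B i)) atTop (𝓝 0))
    (hBfull : volume (limsup B atTop) = 1)
    (hEopen : ∀ i, IsOpen (E i))
    (hEB : ∀ i, E i ⊆ B i)
    (s : ℝ) (hs : 0 ≤ s)
    (hφ : ∀ i, volume (B i) ≤ singularValueFun s (E i)) :
    ENNReal.ofReal s ≤ dimH (limsup E atTop) ∧
      packingDim (limsup E atTop) = (d : ℝ≥0∞) := by
  have hlimsup : ∀ {T : ℕ → Set (EuclideanSpace ℝ (Fin d))}, (∀ i, T i ⊆ unitCube d) →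
      limsup T atTop ⊆ unitCube d := fun hT x hx => by
    obtain ⟨i, hi⟩ := (mem_limsup_iff_frequently_mem.1 hx).exists
    exact hT i hi
  have hEbdd : Bornology.IsBounded (limsup E atTop) :=
    (isBounded_unitCube d).subset (hlimsup fun i => (hEB i).trans (hBcube i))
  have hB0 : ∀ i, volume (B i) ≠ 0 := fun i => by
    obtain ⟨c, r, hr, h | h⟩ := hBball i
    · rw [h]; exact (Metric.measure_ball_pos _ _ hr).ne'
    · rw [h]; exact (Metric.measure_closedBall_pos _ _ hr).ne'
  have hBt : ∀ i, volume (B i) ≠ ∞ := fun i =>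
    ((isBounded_unitCube d).subset (hBcube i)).measure_lt_top.ne
  choose K hKE hK μ hμ hμK hμs using fun i =>
    exists_isCompact_measure_of_le_singularValueFun (hEopen i) (hB0 i) (hBt i) (hφ i)
  have hsd : s ≤ d := by
    rcases hs.eq_or_lt with rfl | hs0
    · positivity
    have h := (le_dimH_of_isCompact_measure hs0 (by positivity) (hB0 0) (hBt 0) (μ 0) (hμK 0)
      (hμs 0)).trans (dimH_mono (subset_univ _))
    rw [Real.dimH_univ_eq_finrank, finrank_euclideanSpace_fin, ← ENNReal.ofReal_natCast] at h
    exact (ENNReal.ofReal_le_ofReal_iff (by positivity)).1 h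
  -- In dimension `0` every diameter vanishes and does not determine a radius; there `s ≤ d` makes
  -- both claims trivial.
  rcases Nat.eq_zero_or_pos d with rfl | hd
  · have hs0 : s = 0 := le_antisymm (by simpa using hsd) hs
    refine ⟨by simp [hs0], le_antisymm ?_ (by simp)⟩
    simpa using packingDim_le_finrank hEbdd
  have : Nonempty (Fin d) := ⟨⟨0, hd⟩⟩
  -- Passing to closed balls enlarges the limsup and keeps the volumes, so both the full measure and
  -- the Frostman bounds carry over.
  choose c ρ hρ hBρ hdiam hvol using fun i => (hBball i).exists_subset_closedBall volume
  have hρ0 : Tendsto ρ atTop (𝓝 0) := by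
    have := hBdiam.div_const 2
    simpa [hdiam] using this
  have hfull : volume (openUnitCube d \
      limsup (fun i => Metric.closedBall (c i) (ρ i)) atTop) = 0 := by
    refine measure_mono_null (sdiff_subset_sdiff (openUnitCube_subset d)
      (limsup_le_limsup (.of_forall hBρ))) ?_
    rw [measure_sdiff (hlimsup hBcube)
      (MeasurableSet.measurableSet_limsup fun i => (hBball i).measurableSet).nullMeasurableSet
      (by simp [hBfull]), hBfull, volume_unitCube, tsub_self]
  refine ⟨?_, ?_⟩
  · choose V hV hVc hVE ν hν1 hνV hνM hνb using fun i =>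
      exists_le_smul_measure_of_isCompact volume (hK i) (hEopen i) (hKE i) (μ i) (hμK i)
    refine le_of_forall_lt fun a ha => ?_
    have hat : a ≠ ∞ := ha.ne_top
    obtain ⟨t, hat, hts⟩ := exists_between ((ENNReal.lt_ofReal_iff_toReal_lt hat).1 ha)
    have ht : 0 < t := ENNReal.toReal_nonneg.trans_lt hat
    refine ((ENNReal.lt_ofReal_iff_toReal_lt ha.ne_top).2 hat).trans_le ?_
    have htd : t < (Module.finrank ℝ (EuclideanSpace ℝ (Fin d)) : ℝ) := by
      rw [finrank_euclideanSpace_fin]; exact hts.trans_le hsd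
    have hstart := isFrostmanOn_two_smul_restrict volume (isOpen_openUnitCube d)
      (volume_openUnitCube d) ht.le htd.le
    refine (hstart.le_dimH_limsup volume hρ hρ0 hV hVc
      (fun i => (hVE i).trans ((hEB i).trans (hBρ i))) hν1 hνV hνM
      (C := 4 * 2 ^ s) (s := s) (by positivity) (fun i x r hr => ?_) ht hts htd
      (isOpen_openUnitCube d) hfull (by positivity)).trans
      (dimH_mono (limsup_le_limsup (.of_forall hVE)))
    rw [← hvol, mul_comm, ← ENNReal.le_div_iff_mul_le (Or.inl (hB0 i)) (Or.inl (hBt i))]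
    refine hνb i r _ (fun y => ?_) x
    rw [ENNReal.le_div_iff_mul_le (Or.inl (hB0 i)) (Or.inl (hBt i)), mul_comm]
    exact hμs i y r hr
  · have hEne : ∀ i, (E i).Nonempty := fun i => by
      refine Nonempty.mono (hKE i) (nonempty_of_measure_ne_zero (μ := μ i) ?_)
      rw [(prob_compl_eq_zero_iff (hK i).measurableSet).1 (hμK i)]
      exact one_ne_zero
    rw [packingDim_limsup_eq volume hρ0 hEopen hEne (fun i => (hEB i).trans (hBρ i))
      (isOpen_openUnitCube d) (openUnitCube_nonempty d) hfull hEbdd, finrank_euclideanSpace_fin]
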